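/- Let $N\ge 1$, and let $0=s_0<s_1<\dots<s_N=1$ and $0=t_0<t_1<\dots<t_N=1$ be arbitrary. The rectangles $[s_{a},s_{a+1}]\times[t_{b},t_{b+1}]$, $0\le a,b<N$, are the cells of a (non-uniform) rectangular mesh of $[0,1]^2$; write $h^x_a=\frac12(s_{a+1}-s_a)$ and $h^y_b=\frac12(t_{b+1}-t_b)$ for the mesh sizes (half the edge lengths of the cells). The grid points are $(x_i,y_j)$, $0\le i,j\le 2N$, where $x_{2k}=s_k$ and $x_{2k+1}=\frac12(s_k+s_{k+1})$, and similarly for $y$. A grid point with $i\in\{0,2N\}$ or $j\in\{0,2N\}$ is a boundary point; the others are interior points. The $Q^2$ spectral element method (continuous $Q^2$ finite elements with $3\times 3$ Gauss--Lobatto quadrature, after inversion of the lumped mass matrix) for $-\Delta u=f$ in $(0,1)^2$ with Dirichlet data is the linear system $\bar L_h\bar{\mathbf u}=\bar{\mathbf f}$ for grid functions $\bar{\mathbf u}=(u_{i,j})_{0\le i,j\le 2N}$, where $\bar L_h$ is the $(2N+1)^2\times(2N+1)^2$ matrix given as follows. At an interior point $(x_i,y_j)$ put $h_a=h^x_{\lfloor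 i/2\rfloor}$, $h_b=h^y_{\lfloor j/2\rfloor}$ and, for even $i$ resp. even $j$, $h_{a-1}=h^x_{i/2-1}$ resp. $h_{b-1}=h^y_{j/2-1}$. - Boundary point: $(\bar L_h\bar{\mathbf u})_{i,j}=u_{i,j}$. - Cell center ($i$, $j$ odd): $$(\bar L_h\bar{\mathbf u})_{i,j}=\frac{2h_a^2+2h_b^2}{h_a^2h_b^2}u_{i,j}-\frac{u_{i+1,j}+u_{i-1,j}}{h_a^2}-\frac{u_{i,j+1}+u_{i,j-1}}{h_b^2}.$$ - Interior edge center, edge parallel to the $y$-axis ($i$ even, $j$ odd): $$(\bar L_h\bar{\mathbf u})_{i,j}=\frac{7h_b^2+4h_ah_{a-1}}{2h_ah_{a-1}h_b^2}u_{i,j}-\frac{4u_{i+1,j}}{h_a(h_a+h_{a-1})}-\frac{4u_{i-1,j}}{h_{a-1}(h_a+h_{a-1})}-\frac{u_{i,j+1}+u_{i,j-1}}{h_b^2}+\frac{u_{i+2,j}}{2h_a(h_a+h_{a-1})}+\frac{u_{i-2,j}}{2h_{a-1}(h_a+h_{a-1})}.$$ - Interior edge center, edge parallel to the $x$-axis ($i$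 odd, $j$ even): the same formula with the roles of $x$ and $y$ (of $i,h_a,h_{a-1}$ and $j,h_b,h_{b-1}$) exchanged. - Interior knot ($i$, $j$ even): $$\begin{aligned}(\bar L_h\bar{\mathbf u})_{i,j}={}&\frac{7h_ah_{a-1}+7h_bh_{b-1}}{2h_ah_{a-1}h_bh_{b-1}}u_{i,j}-\frac{4u_{i+1,j}}{h_a(h_a+h_{a-1})}-\frac{4u_{i-1,j}}{h_{a-1}(h_a+h_{a-1})}-\frac{4u_{i,j+1}}{h_b(h_b+h_{b-1})}-\frac{4u_{i,j-1}}{h_{b-1}(h_b+h_{b-1})}\\&+\frac{u_{i+2,j}}{2h_a(h_a+h_{a-1})}+\frac{u_{i-2,j}}{2h_{a-1}(h_a+h_{a-1})}+\frac{u_{i,j+2}}{2h_b(h_b+h_{b-1})}+\frac{u_{i,j-2}}{2h_{b-1}(h_b+h_{b-1})}.\end{aligned}$$ **Theorem.** Suppose that for all $1\le a,b<N$ (that is, on every four adjacent cells), with $h_a=h^x_a$, $h_{a-1}=h^x_{a-1}$, $h_b=h^y_b$, $h_{b-1}=h^y_{b-1}$, $$h_ah_{a-1}\ge\tfrac{7}{12}\max\{h_b^2,h_{b-1}^2\},\qquad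 h_bh_{b-1}\ge\tfrac{7}{12}\max\{h_a^2,h_{a-1}^2\},$$ $$\min\{h_a,h_{a-1}\}\ge\sqrt{\tfrac13}\,\max\{h_b,h_{b-1}\},\qquad \min\{h_b,h_{b-1}\}\ge\sqrt{\tfrac13}\,\max\{h_a,h_{a-1}\}.$$ Then $\bar L_h$ is invertible and all entries of $\bar L_h^{-1}$ are non-negative. Moreover the scheme satisfies the discrete maximum principle: for every grid function $\bar{\mathbf u}$, if $(\bar L_h\bar{\mathbf u})_{i,j}\le 0$ at all interior points, then $u_{i,j}\le\max\{0,\max_{\text{boundary points}}u\}$ at every interior point $(x_i,y_j)$. -/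

import Mathlib

open scoped Matrix

noncomputable section

/-- The mesh lines of a (possibly non-uniform) partition of `[0,1]` into `N` cells,
`0 = t 0 < t 1 < ⋯ < t N = 1`. -/
structure AxisMesh (N : ℕ) where
  t : Fin (N + 1) → ℝ
  strictMono : StrictMono t
  left : t 0 = 0
  right : t (Fin.last N) = 1

/-- The mesh size `h_k` of the cell number `k`, `0 ≤ k < N`: *half* the length of the cell,
so that the cell has length `2 h_k` (the value for `k ≥ N` is never used). -/
def AxisMesh.h {N : ℕ} (X : AxisMesh N) (k : ℕ) : ℝ :=
  if hk : k < N then (X.t ⟨k + 1, by omega⟩ - X.t ⟨k, by omega⟩) / 2 else 0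

/-- The indices `(i, j)`, `0 ≤ i, j ≤ 2N`, of the grid points: the `3 × 3` Gauss–Lobatto points of
all the `N × N` cells. Cell number `k` of an axis holds the grid indices `2k, 2k+1, 2k+2`, so that
even indices are mesh lines and odd indices are midpoints of cells. -/
abbrev GridIdx (N : ℕ) : Type := Fin (2 * N + 1) × Fin (2 * N + 1)

/-- `(i, j)` is the index of a grid point on the boundary of the unit square. -/
def OnBoundary (N i j : ℕ) : Prop :=
  i = 0 ∨ i = 2 * N ∨ j = 0 ∨ j = 2 * N

/-- The `Q²` scheme at an interior cell center; `ha`, `hb` are the mesh sizes of the cell. -/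
def cellCenterOp (ha hb : ℝ) (u : ℕ → ℕ → ℝ) (i j : ℕ) : ℝ :=
  (2 * ha ^ 2 + 2 * hb ^ 2) / (ha ^ 2 * hb ^ 2) * u i j
    - (1 / ha ^ 2 * u (i + 1) j + 1 / ha ^ 2 * u (i - 1) j
      + 1 / hb ^ 2 * u i (j + 1) + 1 / hb ^ 2 * u i (j - 1))

/-- The `Q²` scheme at the center of an interior edge parallel to the `y`-axis;
`ha'`, `ha` are the mesh sizes in `x` to the left and to the right of the edge. -/
def edgeCenterYOp (ha' ha hb : ℝ) (u : ℕ → ℕ → ℝ) (i j : ℕ) : ℝ :=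
  (7 * hb ^ 2 + 4 * ha * ha') / (2 * ha * ha' * hb ^ 2) * u i j
    - 4 / (ha * (ha + ha')) * u (i + 1) j
    - 4 / (ha' * (ha + ha')) * u (i - 1) j
    - 1 / hb ^ 2 * u i (j + 1) - 1 / hb ^ 2 * u i (j - 1)
    + 1 / (2 * ha * (ha + ha')) * u (i + 2) j
    + 1 / (2 * ha' * (ha + ha')) * u (i - 2) j

/-- The `Q²` scheme at the center of an interior edge parallel to the `x`-axis;
`hb'`, `hb` are the mesh sizes in `y` below and above the edge. -/
def edgeCenterXOp (ha hb' hb : ℝ) (u : ℕ → ℕ → ℝ) (i j : ℕ) : ℝ :=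
  (7 * ha ^ 2 + 4 * hb * hb') / (2 * hb * hb' * ha ^ 2) * u i j
    - 4 / (hb * (hb + hb')) * u i (j + 1)
    - 4 / (hb' * (hb + hb')) * u i (j - 1)
    - 1 / ha ^ 2 * u (i + 1) j - 1 / ha ^ 2 * u (i - 1) j
    + 1 / (2 * hb * (hb + hb')) * u i (j + 2)
    + 1 / (2 * hb' * (hb + hb')) * u i (j - 2)

/-- The `Q²` scheme at an interior knot; `ha'`, `ha` are the mesh sizes in `x` to the left and to
the right, `hb'`, `hb` the mesh sizes in `y` below and above. -/
def knotOp (ha' ha hb' hb : ℝ) (u : ℕ → ℕ → ℝ) (i j : ℕ) : ℝ :=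
  (7 * ha * ha' + 7 * hb * hb') / (2 * ha * ha' * hb * hb') * u i j
    - (4 / (ha * (ha + ha')) * u (i + 1) j
      + 4 / (ha' * (ha + ha')) * u (i - 1) j
      + 4 / (hb * (hb + hb')) * u i (j + 1)
      + 4 / (hb' * (hb + hb')) * u i (j - 1))
    + 1 / (2 * ha * (ha + ha')) * u (i + 2) j
    + 1 / (2 * ha' * (ha + ha')) * u (i - 2) j
    + 1 / (2 * hb * (hb + hb')) * u i (j + 2)
    + 1 / (2 * hb' * (hb + hb')) * u i (j - 2)

open Classical in
/-- The `Q²` spectral element scheme for `-Δ` with Dirichlet boundary conditions on the mesh with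
mesh sizes `hx k` in `x` and `hy k` in `y`, applied to the grid function `u` at the grid point
`(i, j)`. The cell with index `i / 2` is the one to the right of `x_i` if `i` is even, and the one
that has `x_i` as its midpoint if `i` is odd. -/
def q2Scheme (N : ℕ) (hx hy : ℕ → ℝ) (u : ℕ → ℕ → ℝ) (i j : ℕ) : ℝ :=
  if OnBoundary N i j then u i j
  else if Odd i ∧ Odd j then cellCenterOp (hx (i / 2)) (hy (j / 2)) u i j
  else if Even i ∧ Odd j then
    edgeCenterYOp (hx (i / 2 - 1)) (hx (i / 2)) (hy (j / 2)) u i j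
  else if Odd i ∧ Even j then
    edgeCenterXOp (hx (i / 2)) (hy (j / 2 - 1)) (hy (j / 2)) u i j
  else knotOp (hx (i / 2 - 1)) (hx (i / 2)) (hy (j / 2 - 1)) (hy (j / 2)) u i j

/-- The matrix `L̄_h` of the linear map `u ↦ q2Scheme N hx hy u` on grid functions: its column `q`
is the value of the scheme on the grid function that is `1` at `q` and `0` elsewhere. -/
def q2Matrix (N : ℕ) (hx hy : ℕ → ℝ) : Matrix (GridIdx N) (GridIdx N) ℝ :=
  Matrix.of fun p q =>
    q2Scheme N hx hy
      (fun i j => if i = (q.1 : ℕ) ∧ j = (q.2 : ℕ) then 1 else 0) (p.1 : ℕ) (p.2 : ℕ)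

/-- A square matrix is monotone if it is invertible and its inverse is entrywise nonnegative. -/
def IsMonotoneMatrix {ι : Type*} [Fintype ι] [DecidableEq ι] (A : Matrix ι ι ℝ) : Prop :=
  IsUnit A ∧ ∀ p q, 0 ≤ A⁻¹ p q

/-- The discrete maximum principle: if `(A u)_p ≤ 0` at all the interior grid points, then
`u ≤ max {0, max u|_∂Ω}` at all the interior grid points. -/
def DiscreteMaximumPrinciple (N : ℕ) (A : Matrix (GridIdx N) (GridIdx N) ℝ) : Prop :=
  ∀ u : GridIdx N → ℝ,
    (∀ p : GridIdx N, ¬ OnBoundary N p.1 p.2 → (A *ᵥ u) p ≤ 0) →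
      ∀ p : GridIdx N, ¬ OnBoundary N p.1 p.2 →
        u p ≤ max 0 (⨆ q : {q : GridIdx N // OnBoundary N q.1 q.2}, u q)

/-- The mesh constraints on any four adjacent cells: columns `a - 1`, `a` and rows `b - 1`, `b`. -/
def MeshConstraints (N : ℕ) (hx hy : ℕ → ℝ) : Prop :=
  ∀ a b : ℕ, 1 ≤ a → a < N → 1 ≤ b → b < N →
    7 / 12 * max (hy b ^ 2) (hy (b - 1) ^ 2) ≤ hx a * hx (a - 1) ∧
    7 / 12 * max (hx a ^ 2) (hx (a - 1) ^ 2) ≤ hy b * hy (b - 1) ∧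
    √(1 / 3) * max (hy b) (hy (b - 1)) ≤ min (hx a) (hx (a - 1)) ∧
    √(1 / 3) * max (hx a) (hx (a - 1)) ≤ min (hy b) (hy (b - 1))

end

/-!
The scheme is, at interior grid points, the sum of two one-dimensional difference operators
(`axisDiff`), one for each axis (`q2Scheme_eq_axisDiff`). At mesh lines `axisDiff` has positive
couplings to the points two steps away, so the matrix of the scheme need not be an M-matrix; these
couplings have to be absorbed by the negative couplings to the midpoints in between.
At a mesh line the two combine to a positive multiple of `8 u(midpoint) - u(far point)`.

Suppose that `u ≥ 0` and that the scheme applied to `u` is nonnegative. At a point that is a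
midpoint for the `x`-axis, the inequality for the scheme bounds the sum of the two neighbours in `x`
by a multiple of the value at the midpoint, and the mesh constraints say exactly that the multiple is
at most `8` (`neighbours_le_eight_mul`). This is used first at cell centers, then, with the outcome,
at edge centers, so that all the quantities `8 u(midpoint) - u(far point)` are nonnegative. The
scheme is therefore bounded by its diagonal part: where the scheme is positive, `u` is positive
(`pos_of_q2Scheme_pos`).

The scheme is exact for quadratic polynomials, so `e = C - x²` is a positive grid function on
which the scheme is positive everywhere. If the scheme is nonnegative on `u` and `u` has a negative
value, let `-t` be the minimum of `u / e`; then `u + t e ≥ 0` vanishes at some point although the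
scheme is positive there, a contradiction. So the scheme is inverse-nonnegative
(`nonneg_of_q2Scheme_nonneg`). Since it annihilates constants at interior points, the
discrete maximum principle follows by applying this to `M - u`.
-/

/-! ### The one-dimensional difference operators -/

/-- The one-dimensional operator for `-d²/dx²` at an interior index `i`: the central difference at
the midpoint of a cell, the five-point formula at a mesh line. At a mesh line the couplings to
`i ± 1` and `i ± 2` are grouped into the differences `8 g (i ± 1) - g (i ± 2)`. -/
noncomputable def axisDiff (h : ℕ → ℝ) (g : ℕ → ℝ) (i : ℕ) : ℝ :=
  if Odd i then (2 * g i - g (i - 1) - g (i + 1)) / h (i / 2) ^ 2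
  else 7 / (2 * h (i / 2) * h (i / 2 - 1)) * g i
    - (8 * g (i + 1) - g (i + 2)) / (2 * h (i / 2) * (h (i / 2) + h (i / 2 - 1)))
    - (8 * g (i - 1) - g (i - 2)) / (2 * h (i / 2 - 1) * (h (i / 2) + h (i / 2 - 1)))

/-- The diagonal coefficient of `axisDiff` at the index `i`. -/
noncomputable def axisDiag (h : ℕ → ℝ) (i : ℕ) : ℝ :=
  if Odd i then 2 / h (i / 2) ^ 2 else 7 / (2 * h (i / 2) * h (i / 2 - 1))

theorem axisDiff_add (h f g : ℕ → ℝ) (i : ℕ) :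
    axisDiff h (fun k => f k + g k) i = axisDiff h f i + axisDiff h g i := by
  unfold axisDiff
  split_ifs <;> ring

theorem axisDiff_const_mul (h g : ℕ → ℝ) (c : ℝ) (i : ℕ) :
    axisDiff h (fun k => c * g k) i = c * axisDiff h g i := by
  unfold axisDiff
  split_ifs <;> ring

theorem axisDiff_const {N : ℕ} {h : ℕ → ℝ} (hh : ∀ k < N, 0 < h k) (c : ℝ) {i : ℕ}
    (hi : 0 < i) (hiN : i < 2 * N) : axisDiff h (fun _ => c) i = 0 := by
  unfold axisDiff
  split_ifs with ho
  · ring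
  · rw [Nat.not_odd_iff_even] at ho
    obtain ⟨a, rfl⟩ := ho
    have h1 := hh ((a + a) / 2) (by omega)
    have h2 := hh ((a + a) / 2 - 1) (by omega)
    field_simp
    ring

/-- The coordinate of the grid point `i` on an axis with mesh sizes `h`: every step from one grid
point to the next is half a cell. -/
noncomputable def gridPos (h : ℕ → ℝ) (i : ℕ) : ℝ := ∑ k ∈ Finset.range i, h (k / 2)

theorem gridPos_succ (h : ℕ → ℝ) (i : ℕ) : gridPos h (i + 1) = gridPos h i + h (i / 2) :=
  Finset.sum_range_succ _ _

theorem gridPos_nonneg {N : ℕ} {h : ℕ → ℝ} (hh : ∀ k < N, 0 < h k) {i : ℕ} (hi : i ≤ 2 * N) :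
    0 ≤ gridPos h i :=
  Finset.sum_nonneg fun k hk => (hh _ (by have := Finset.mem_range.1 hk; omega)).le

theorem gridPos_le {N : ℕ} {h : ℕ → ℝ} (hh : ∀ k < N, 0 < h k) {i : ℕ} (hi : i ≤ 2 * N) :
    gridPos h i ≤ gridPos h (2 * N) :=
  Finset.sum_le_sum_of_subset_of_nonneg (Finset.range_mono hi)
    fun k hk _ => (hh _ (by have := Finset.mem_range.1 hk; omega)).le

theorem axisDiff_gridPos_sq {N : ℕ} {h : ℕ → ℝ} (hh : ∀ k < N, 0 < h k) {i : ℕ}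
    (hi : 0 < i) (hiN : i < 2 * N) : axisDiff h (fun k => gridPos h k ^ 2) i = -2 := by
  unfold axisDiff
  split_ifs with ho
  · obtain ⟨a, rfl⟩ := ho
    have e1 : (2 * a + 1) / 2 = a := by omega
    have e2 : 2 * a / 2 = a := by omega
    have h1 := hh a (by omega)
    simp only [Nat.add_sub_cancel, gridPos_succ, e1, e2]
    field_simp
    ring
  · rw [Nat.not_odd_iff_even] at ho
    obtain ⟨b, rfl⟩ := ho
    obtain ⟨a, rfl⟩ : ∃ a, b = a + 1 := ⟨b - 1, by omega⟩
    have e0 : a + 1 + (a + 1) = 2 * a + 1 + 1 := by omega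
    have e1 : (2 * a + 1) / 2 = a := by omega
    have e2 : 2 * a / 2 = a := by omega
    have e3 : (2 * a + 1 + 1) / 2 = a + 1 := by omega
    have e4 : (2 * a + 1 + 1 + 1) / 2 = a + 1 := by omega
    have e5 : 2 * a + 1 + 1 - 2 = 2 * a := by omega
    have e6 : 2 * a + 1 + 1 + 2 = 2 * a + 1 + 1 + 1 + 1 := by omega
    have h1 := hh a (by omega)
    have h2 := hh (a + 1) (by omega)
    simp only [e0, e5, e6, e3, Nat.add_sub_cancel, gridPos_succ, e1, e2, e4]
    field_simp
    ring

theorem axisDiff_le_of_odd {h g : ℕ → ℝ} {i : ℕ} (ho : Odd i) (hl : 0 ≤ g (i - 1))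
    (hr : 0 ≤ g (i + 1)) : axisDiff h g i ≤ axisDiag h i * g i := by
  unfold axisDiff axisDiag
  rw [if_pos ho, if_pos ho, div_mul_eq_mul_div]
  gcongr
  linarith

theorem axisDiff_le_of_even {N : ℕ} {h g : ℕ → ℝ} (hh : ∀ k < N, 0 < h k) {i : ℕ}
    (he : Even i) (hi : 0 < i) (hiN : i < 2 * N) (hl : g (i - 2) ≤ 8 * g (i - 1))
    (hr : g (i + 2) ≤ 8 * g (i + 1)) : axisDiff h g i ≤ axisDiag h i * g i := by
  have ho : ¬ Odd i := Nat.not_odd_iff_even.2 he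
  have h1 := hh (i / 2) (by omega)
  have h2 := hh (i / 2 - 1) (by omega)
  unfold axisDiff axisDiag
  rw [if_neg ho, if_neg ho]
  have p1 : 0 ≤ (8 * g (i + 1) - g (i + 2)) / (2 * h (i / 2) * (h (i / 2) + h (i / 2 - 1))) :=
    div_nonneg (by linarith) (by positivity)
  have p2 : 0 ≤ (8 * g (i - 1) - g (i - 2)) / (2 * h (i / 2 - 1) * (h (i / 2) + h (i / 2 - 1))) :=
    div_nonneg (by linarith) (by positivity)
  linarith

theorem axisDiag_pos {N : ℕ} {h : ℕ → ℝ} (hh : ∀ k < N, 0 < h k) {i : ℕ}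
    (hiN : i < 2 * N) : 0 < axisDiag h i := by
  have h1 := hh (i / 2) (by omega)
  have h2 := hh (i / 2 - 1) (by omega)
  unfold axisDiag
  split_ifs <;> positivity

/-- The absorption step: at a midpoint `i`, if the operator in one direction plus a multiple `K` of
the value (which stands for the other direction) is nonnegative, with `K` small relative to
the mesh size, then both neighbours are at most `8` times the value at the midpoint. -/
theorem neighbours_le_eight_mul {h g : ℕ → ℝ} {i : ℕ} {K : ℝ} (ho : Odd i) (hpos : 0 < h (i / 2))
    (hl : 0 ≤ g (i - 1)) (hc : 0 ≤ g i) (hr : 0 ≤ g (i + 1)) (hK : K * h (i / 2) ^ 2 ≤ 6)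
    (H : 0 ≤ axisDiff h g i + K * g i) : g (i - 1) ≤ 8 * g i ∧ g (i + 1) ≤ 8 * g i := by
  unfold axisDiff at H
  rw [if_pos ho] at H
  have h2 : 0 < h (i / 2) ^ 2 := by positivity
  have H' : 0 ≤ (2 * g i - g (i - 1) - g (i + 1)) + K * h (i / 2) ^ 2 * g i := by
    have := mul_nonneg H h2.le
    rw [add_mul, div_mul_cancel₀ _ h2.ne'] at this
    linarith
  have := mul_le_mul_of_nonneg_right hK hc
  constructor <;> linarith

/-! ### The mesh constraints -/

theorem MeshConstraints.swap {N : ℕ} {hx hy : ℕ → ℝ} (hm : MeshConstraints N hx hy) :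
    MeshConstraints N hy hx := fun a b ha ha' hb hb' =>
  have ⟨h1, h2, h3, h4⟩ := hm b a hb hb' ha ha'
  ⟨h2, h1, h4, h3⟩

theorem MeshConstraints.sq_le {N : ℕ} {hx hy : ℕ → ℝ} (hxp : ∀ k < N, 0 < hx k)
    (hm : MeshConstraints N hx hy) (hN : 2 ≤ N) {a b : ℕ} (ha : a < N) (hb : b < N) :
    hx a ^ 2 ≤ 3 * hy b ^ 2 := by
  -- Every cell number is one of the two in some pair of adjacent cells.
  obtain ⟨a', ha1, haN, haa⟩ : ∃ a', 1 ≤ a' ∧ a' < N ∧ (a = a' ∨ a = a' - 1) := by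
    rcases Nat.eq_zero_or_pos a with rfl | h
    · exact ⟨1, le_rfl, by omega, Or.inr rfl⟩
    · exact ⟨a, h, ha, Or.inl rfl⟩
  obtain ⟨b', hb1, hbN, hbb⟩ : ∃ b', 1 ≤ b' ∧ b' < N ∧ (b = b' ∨ b = b' - 1) := by
    rcases Nat.eq_zero_or_pos b with rfl | h
    · exact ⟨1, le_rfl, by omega, Or.inr rfl⟩
    · exact ⟨b, h, hb, Or.inl rfl⟩
  have h4 := (hm a' b' ha1 haN hb1 hbN).2.2.2
  have hA : hx a ≤ max (hx a') (hx (a' - 1)) := by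
    rcases haa with rfl | rfl
    · exact le_max_left _ _
    · exact le_max_right _ _
  have hB : min (hy b') (hy (b' - 1)) ≤ hy b := by
    rcases hbb with rfl | rfl
    · exact min_le_left _ _
    · exact min_le_right _ _
  have h5 : √(1 / 3) * hx a ≤ hy b :=
    (mul_le_mul_of_nonneg_left hA (Real.sqrt_nonneg _)).trans (h4.trans hB)
  have h6 := pow_le_pow_left₀ (mul_nonneg (Real.sqrt_nonneg _) (hxp a ha).le) h5 2
  rw [mul_pow, Real.sq_sqrt (by norm_num)] at h6
  linarith

theorem MeshConstraints.axisDiag_mul_sq_le {N : ℕ} {hx hy : ℕ → ℝ} (hxp : ∀ k < N, 0 < hx k)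
    (hyp : ∀ k < N, 0 < hy k) (hm : MeshConstraints N hx hy) (hN : 2 ≤ N) {a j : ℕ} (ha : a < N)
    (hj : 0 < j) (hjN : j < 2 * N) : axisDiag hy j * hx a ^ 2 ≤ 6 := by
  unfold axisDiag
  split_ifs with ho
  · have h1 := hm.sq_le hxp hN ha (b := j / 2) (by omega)
    have h2 := hyp (j / 2) (by omega)
    rw [div_mul_eq_mul_div, div_le_iff₀ (by positivity)]
    linarith
  · rw [Nat.not_odd_iff_even] at ho
    have hb : 1 ≤ j / 2 := by obtain ⟨b, rfl⟩ := ho; omega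
    have hb' : j / 2 < N := by omega
    have h1 := hyp (j / 2) hb'
    have h2 := hyp (j / 2 - 1) (by omega)
    have h3 : 7 / 12 * hx a ^ 2 ≤ hy (j / 2) * hy (j / 2 - 1) := by
      rcases Nat.eq_zero_or_pos a with rfl | h
      · have := (hm 1 (j / 2) le_rfl (by omega) hb hb').2.1
        exact (mul_le_mul_of_nonneg_left (le_max_right _ _) (by norm_num)).trans this
      · have := (hm a (j / 2) h ha hb hb').2.1
        exact (mul_le_mul_of_nonneg_left (le_max_left _ _) (by norm_num)).trans this
    rw [div_mul_eq_mul_div, div_le_iff₀ (by positivity)]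
    linarith

/-! ### Domination of the scheme by its diagonal -/

/-- Where the `x`-index is a midpoint, the operator in `y` is dominated by its diagonal. At mesh
lines this rests on the absorption step at cell centers. -/
theorem axisDiff_le_of_odd_left {N : ℕ} {hx hy : ℕ → ℝ} (hxp : ∀ k < N, 0 < hx k)
    (hyp : ∀ k < N, 0 < hy k) (hm : MeshConstraints N hx hy) {u : ℕ → ℕ → ℝ}
    (hu : ∀ i ≤ 2 * N, ∀ j ≤ 2 * N, 0 ≤ u i j)
    (hL : ∀ i j, 0 < i → i < 2 * N → 0 < j → j < 2 * N →
      0 ≤ axisDiff hx (fun k => u k j) i + axisDiff hy (u i) j)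
    {i j : ℕ} (hi : Odd i) (hiN : i < 2 * N) (hj : 0 < j) (hjN : j < 2 * N) :
    axisDiff hy (u i) j ≤ axisDiag hy j * u i j := by
  have hi0 := hi.pos
  rcases Nat.even_or_odd j with he | ho
  · obtain ⟨b, rfl⟩ := he
    have key : ∀ k, Odd k → k < 2 * N →
        u i (k - 1) ≤ 8 * u i k ∧ u i (k + 1) ≤ 8 * u i k := by
      intro k hk hkN
      refine neighbours_le_eight_mul (K := axisDiag hx i) hk (hyp _ (by omega))
        (hu _ (by omega) _ (by omega)) (hu _ (by omega) _ (by omega))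
        (hu _ (by omega) _ (by omega))
        (hm.swap.axisDiag_mul_sq_le hyp hxp (by omega) (by omega) hi0 hiN) ?_
      have h1 := hL i k hi0 hiN hk.pos hkN
      have h2 := axisDiff_le_of_odd (h := hx) (g := fun k' => u k' k) hi
        (hu _ (by omega) _ (by omega)) (hu _ (by omega) _ (by omega))
      linarith
    refine axisDiff_le_of_even hyp ⟨b, rfl⟩ hj hjN ?_ ?_
    · exact (key (b + b - 1) ⟨b - 1, by omega⟩ (by omega)).1
    · exact (key (b + b + 1) ⟨b, by omega⟩ (by omega)).2
  · exact axisDiff_le_of_odd ho (hu _ (by omega) _ (by omega)) (hu _ (by omega) _ (by omega))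

/-- The operator in `x` is dominated by its diagonal at every interior point. At mesh lines this
rests on the absorption step at the neighbouring midpoints, which are cell centers or edge centers;
there `axisDiff_le_of_odd_left` controls the operator in `y`. -/
theorem axisDiff_le_left {N : ℕ} {hx hy : ℕ → ℝ} (hxp : ∀ k < N, 0 < hx k)
    (hyp : ∀ k < N, 0 < hy k) (hm : MeshConstraints N hx hy) {u : ℕ → ℕ → ℝ}
    (hu : ∀ i ≤ 2 * N, ∀ j ≤ 2 * N, 0 ≤ u i j)
    (hL : ∀ i j, 0 < i → i < 2 * N → 0 < j → j < 2 * N →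
      0 ≤ axisDiff hx (fun k => u k j) i + axisDiff hy (u i) j)
    {i j : ℕ} (hi : 0 < i) (hiN : i < 2 * N) (hj : 0 < j) (hjN : j < 2 * N) :
    axisDiff hx (fun k => u k j) i ≤ axisDiag hx i * u i j := by
  rcases Nat.even_or_odd i with he | ho
  · obtain ⟨a, rfl⟩ := he
    have key : ∀ k, Odd k → k < 2 * N →
        u (k - 1) j ≤ 8 * u k j ∧ u (k + 1) j ≤ 8 * u k j := by
      intro k hk hkN
      refine neighbours_le_eight_mul (h := hx) (g := fun k' => u k' j) (K := axisDiag hy j) hk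
        (hxp _ (by omega))
        (hu _ (by omega) _ (by omega)) (hu _ (by omega) _ (by omega))
        (hu _ (by omega) _ (by omega))
        (hm.axisDiag_mul_sq_le hxp hyp (by omega) (by omega) hj hjN) ?_
      have h1 := hL k j hk.pos hkN hj hjN
      have h2 := axisDiff_le_of_odd_left hxp hyp hm hu hL hk hkN hj hjN
      linarith
    refine axisDiff_le_of_even hxp ⟨a, rfl⟩ hi hiN ?_ ?_
    · exact (key (a + a - 1) ⟨a - 1, by omega⟩ (by omega)).1
    · exact (key (a + a + 1) ⟨a, by omega⟩ (by omega)).2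
  · exact axisDiff_le_of_odd (h := hx) (g := fun k => u k j) ho
      (hu _ (by omega) _ (by omega)) (hu _ (by omega) _ (by omega))

theorem q2Scheme_of_onBoundary {N : ℕ} {i j : ℕ} (hx hy : ℕ → ℝ) (u : ℕ → ℕ → ℝ)
    (hb : OnBoundary N i j) : q2Scheme N hx hy u i j = u i j := if_pos hb

theorem not_onBoundary_iff {N i j : ℕ} (hi : i ≤ 2 * N) (hj : j ≤ 2 * N) :
    ¬ OnBoundary N i j ↔ (0 < i ∧ i < 2 * N) ∧ 0 < j ∧ j < 2 * N := by
  unfold OnBoundary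
  omega

theorem q2Scheme_eq_axisDiff {N : ℕ} {hx hy : ℕ → ℝ} (hxp : ∀ k < N, 0 < hx k)
    (hyp : ∀ k < N, 0 < hy k) (u : ℕ → ℕ → ℝ) {i j : ℕ} (hi : 0 < i) (hiN : i < 2 * N)
    (hj : 0 < j) (hjN : j < 2 * N) :
    q2Scheme N hx hy u i j = axisDiff hx (fun k => u k j) i + axisDiff hy (u i) j := by
  have hb : ¬ OnBoundary N i j := by unfold OnBoundary; omega
  have a1 := hxp (i / 2) (by omega)
  have a2 := hxp (i / 2 - 1) (by omega)
  have b1 := hyp (j / 2) (by omega)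
  have b2 := hyp (j / 2 - 1) (by omega)
  unfold q2Scheme axisDiff
  rcases Nat.even_or_odd i with ei | oi <;> rcases Nat.even_or_odd j with ej | oj
  · have ni := Nat.not_odd_iff_even.2 ei
    have nj := Nat.not_odd_iff_even.2 ej
    simp only [hb, ni, nj, ei, ej, if_false, and_false, false_and, knotOp]
    field_simp
    ring
  · have ni := Nat.not_odd_iff_even.2 ei
    simp only [hb, ni, oj, ei, if_false, if_true, and_self, false_and, edgeCenterYOp]
    field_simp
    ring
  · have ni := Nat.not_even_iff_odd.2 oi
    have nj := Nat.not_odd_iff_even.2 ej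
    simp only [hb, ni, nj, oi, ej, if_false, if_true, and_self, and_false, edgeCenterXOp]
    field_simp
    ring
  · simp only [hb, oi, oj, if_false, if_true, and_self, cellCenterOp]
    field_simp
    ring

/-- On nonnegative grid functions on which the scheme is nonnegative, the scheme is dominated by its
diagonal; so it can be positive only where the grid function is. -/
theorem pos_of_q2Scheme_pos {N : ℕ} {hx hy : ℕ → ℝ} (hxp : ∀ k < N, 0 < hx k)
    (hyp : ∀ k < N, 0 < hy k) (hm : MeshConstraints N hx hy) {u : ℕ → ℕ → ℝ}
    (hu : ∀ i ≤ 2 * N, ∀ j ≤ 2 * N, 0 ≤ u i j)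
    (hL : ∀ i ≤ 2 * N, ∀ j ≤ 2 * N, 0 ≤ q2Scheme N hx hy u i j)
    {i j : ℕ} (hi : i ≤ 2 * N) (hj : j ≤ 2 * N) (hp : 0 < q2Scheme N hx hy u i j) :
    0 < u i j := by
  by_cases hb : OnBoundary N i j
  · rwa [q2Scheme_of_onBoundary hx hy u hb] at hp
  · obtain ⟨⟨hi0, hiN⟩, hj0, hjN⟩ := (not_onBoundary_iff hi hj).1 hb
    rw [q2Scheme_eq_axisDiff hxp hyp u hi0 hiN hj0 hjN] at hp
    have hL' : ∀ i j, 0 < i → i < 2 * N → 0 < j → j < 2 * N →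
        0 ≤ axisDiff hx (fun k => u k j) i + axisDiff hy (u i) j := fun i j h1 h2 h3 h4 => by
      rw [← q2Scheme_eq_axisDiff hxp hyp u h1 h2 h3 h4]
      exact hL i h2.le j h4.le
    have h1 := axisDiff_le_left hxp hyp hm hu hL' hi0 hiN hj0 hjN
    have h2 := axisDiff_le_left (u := fun a b => u b a) hyp hxp hm.swap
      (fun i hi j hj => hu j hj i hi)
      (fun i j h1 h2 h3 h4 => (hL' j i h3 h4 h1 h2).trans_eq (add_comm _ _)) hj0 hjN hi0 hiN
    have h3 : 0 < (axisDiag hx i + axisDiag hy j) * u i j := by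
      rw [add_mul]
      exact hp.trans_le (add_le_add h1 h2)
    exact pos_of_mul_pos_right h3 (add_pos (axisDiag_pos hxp hiN) (axisDiag_pos hyp hjN)).le

/-! ### Inverse-nonnegativity of the scheme -/

theorem q2Scheme_add (N : ℕ) (hx hy : ℕ → ℝ) (u v : ℕ → ℕ → ℝ) (i j : ℕ) :
    q2Scheme N hx hy (u + v) i j = q2Scheme N hx hy u i j + q2Scheme N hx hy v i j := by
  unfold q2Scheme cellCenterOp edgeCenterXOp edgeCenterYOp knotOp
  simp only [Pi.add_apply]
  split_ifs <;> ring

theorem q2Scheme_smul (N : ℕ) (hx hy : ℕ → ℝ) (c : ℝ) (u : ℕ → ℕ → ℝ) (i j : ℕ) :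
    q2Scheme N hx hy (c • u) i j = c * q2Scheme N hx hy u i j := by
  unfold q2Scheme cellCenterOp edgeCenterXOp edgeCenterYOp knotOp
  simp only [Pi.smul_apply, smul_eq_mul]
  split_ifs <;> ring

theorem q2Scheme_const {N : ℕ} {hx hy : ℕ → ℝ} (hxp : ∀ k < N, 0 < hx k)
    (hyp : ∀ k < N, 0 < hy k) (c : ℝ) {i j : ℕ} (hi : 0 < i) (hiN : i < 2 * N)
    (hj : 0 < j) (hjN : j < 2 * N) : q2Scheme N hx hy (fun _ _ => c) i j = 0 := by
  rw [q2Scheme_eq_axisDiff hxp hyp _ hi hiN hj hjN, axisDiff_const hxp c hi hiN,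
    axisDiff_const hyp c hj hjN, add_zero]

/-- The function `C - x²` with `C = 1 + (length of the axis)²`: a positive grid function on
which the scheme is positive. -/
noncomputable def barrier (N : ℕ) (h : ℕ → ℝ) (i _j : ℕ) : ℝ :=
  gridPos h (2 * N) ^ 2 + 1 + -1 * gridPos h i ^ 2

theorem barrier_pos {N : ℕ} {h : ℕ → ℝ} (hh : ∀ k < N, 0 < h k) {i : ℕ} (hi : i ≤ 2 * N)
    (j : ℕ) : 0 < barrier N h i j := by
  have := pow_le_pow_left₀ (gridPos_nonneg hh hi) (gridPos_le hh hi) 2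
  unfold barrier
  linarith

theorem q2Scheme_barrier_pos {N : ℕ} {hx hy : ℕ → ℝ} (hxp : ∀ k < N, 0 < hx k)
    (hyp : ∀ k < N, 0 < hy k) {i j : ℕ} (hi : i ≤ 2 * N) (hj : j ≤ 2 * N) :
    0 < q2Scheme N hx hy (barrier N hx) i j := by
  by_cases hb : OnBoundary N i j
  · rw [q2Scheme_of_onBoundary hx hy _ hb]
    exact barrier_pos hxp hi j
  · obtain ⟨⟨hi0, hiN⟩, hj0, hjN⟩ := (not_onBoundary_iff hi hj).1 hb
    rw [q2Scheme_eq_axisDiff hxp hyp _ hi0 hiN hj0 hjN]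
    have h1 : axisDiff hy (barrier N hx i) j = 0 := axisDiff_const hyp _ hj0 hjN
    have h2 : axisDiff hx (fun k => barrier N hx k j) i = 2 := by
      unfold barrier
      rw [axisDiff_add, axisDiff_const hxp _ hi0 hiN, axisDiff_const_mul,
        axisDiff_gridPos_sq hxp hi0 hiN]
      norm_num
    rw [h1, h2]
    norm_num

theorem nonneg_of_q2Scheme_nonneg {N : ℕ} {hx hy : ℕ → ℝ} (hxp : ∀ k < N, 0 < hx k)
    (hyp : ∀ k < N, 0 < hy k) (hm : MeshConstraints N hx hy) {u : ℕ → ℕ → ℝ}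
    (hL : ∀ i ≤ 2 * N, ∀ j ≤ 2 * N, 0 ≤ q2Scheme N hx hy u i j) :
    ∀ i ≤ 2 * N, ∀ j ≤ 2 * N, 0 ≤ u i j := by
  set e := barrier N hx with he
  obtain ⟨⟨a, b⟩, hab, hmin⟩ := Finset.exists_min_image
    (Finset.Iic (2 * N) ×ˢ Finset.Iic (2 * N)) (fun p : ℕ × ℕ => u p.1 p.2 / e p.1 p.2)
    ⟨(0, 0), by simp⟩
  obtain ⟨ha, hb⟩ : a ≤ 2 * N ∧ b ≤ 2 * N := by simpa using hab
  have hmin' : ∀ i ≤ 2 * N, ∀ j ≤ 2 * N, u a b / e a b * e i j ≤ u i j := fun i hi j hj =>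
    (le_div_iff₀ (barrier_pos hxp hi j)).1 (hmin (i, j) (by simp [hi, hj]))
  by_cases ht : 0 ≤ u a b / e a b
  · exact fun i hi j hj => (mul_nonneg ht (barrier_pos hxp hi j).le).trans (hmin' i hi j hj)
  · exfalso
    obtain ⟨t, htdef⟩ : ∃ t, t = -(u a b / e a b) := ⟨_, rfl⟩
    have htpos : 0 < t := by linarith
    have hv : ∀ i ≤ 2 * N, ∀ j ≤ 2 * N, 0 ≤ (u + t • e) i j := fun i hi j hj => by
      have := hmin' i hi j hj
      simp only [Pi.add_apply, Pi.smul_apply, smul_eq_mul, htdef]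
      linarith
    have hLv : ∀ i ≤ 2 * N, ∀ j ≤ 2 * N, 0 < q2Scheme N hx hy (u + t • e) i j :=
      fun i hi j hj => by
        rw [q2Scheme_add, q2Scheme_smul]
        exact add_pos_of_nonneg_of_pos (hL i hi j hj)
          (mul_pos htpos (q2Scheme_barrier_pos hxp hyp hi hj))
    have h0 := pos_of_q2Scheme_pos hxp hyp hm hv (fun i hi j hj => (hLv i hi j hj).le) ha hb
      (hLv a ha b hb)
    have : (u + t • e) a b = 0 := by
      simp only [Pi.add_apply, Pi.smul_apply, smul_eq_mul, htdef, neg_mul]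
      rw [div_mul_cancel₀ _ (barrier_pos hxp ha b).ne', add_neg_cancel]
    linarith

/-! ### The matrix of the scheme -/

/-- The extension by zero of a grid function to all pairs of natural numbers. -/
noncomputable def gridExtend {N : ℕ} (u : GridIdx N → ℝ) : ℕ → ℕ → ℝ :=
  ∑ q : GridIdx N, u q • fun i j => if i = (q.1 : ℕ) ∧ j = (q.2 : ℕ) then (1 : ℝ) else 0

theorem gridExtend_apply {N : ℕ} (u : GridIdx N → ℝ) (p : GridIdx N) :
    gridExtend u p.1 p.2 = u p := by
  unfold gridExtend
  simp only [Finset.sum_apply, Pi.smul_apply, smul_eq_mul]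
  rw [Finset.sum_eq_single p]
  · simp
  · intro q _ hq
    rw [if_neg, mul_zero]
    rintro ⟨h1, h2⟩
    exact hq (Prod.ext (Fin.ext h1.symm) (Fin.ext h2.symm))
  · simp

theorem q2Matrix_mulVec {N : ℕ} (hx hy : ℕ → ℝ) (u : GridIdx N → ℝ) (p : GridIdx N) :
    (q2Matrix N hx hy *ᵥ u) p = q2Scheme N hx hy (gridExtend u) p.1 p.2 := by
  let L : (ℕ → ℕ → ℝ) →ₗ[ℝ] ℝ :=
    { toFun := fun v => q2Scheme N hx hy v p.1 p.2
      map_add' := fun v w => q2Scheme_add N hx hy v w _ _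
      map_smul' := fun c v => q2Scheme_smul N hx hy c v _ _ }
  change _ = L (gridExtend u)
  unfold gridExtend
  rw [map_sum]
  refine Finset.sum_congr rfl fun q _ => ?_
  rw [map_smul, smul_eq_mul, mul_comm]
  rfl

theorem nonneg_of_q2Matrix_mulVec_nonneg {N : ℕ} {hx hy : ℕ → ℝ} (hxp : ∀ k < N, 0 < hx k)
    (hyp : ∀ k < N, 0 < hy k) (hm : MeshConstraints N hx hy) {u : GridIdx N → ℝ}
    (hL : ∀ p, 0 ≤ (q2Matrix N hx hy *ᵥ u) p) (p : GridIdx N) : 0 ≤ u p := by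
  rw [← gridExtend_apply u p]
  refine nonneg_of_q2Scheme_nonneg hxp hyp hm (fun i hi j hj => ?_) _ (by omega) _ (by omega)
  have := hL (⟨i, by omega⟩, ⟨j, by omega⟩)
  rwa [q2Matrix_mulVec] at this

/-- A square matrix `A` with `A u ≥ 0 → u ≥ 0` is monotone. -/
theorem isMonotoneMatrix_of_forall_nonneg {ι : Type*} [Fintype ι] [DecidableEq ι]
    {A : Matrix ι ι ℝ} (hA : ∀ u : ι → ℝ, (∀ p, 0 ≤ (A *ᵥ u) p) → ∀ p, 0 ≤ u p) :
    IsMonotoneMatrix A := by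
  have hunit : IsUnit A := by
    rw [← Matrix.mulVec_injective_iff_isUnit]
    intro u v huv
    have huv' : A *ᵥ u = A *ᵥ v := huv
    funext p
    have h1 := hA (u - v) (fun q => by rw [Matrix.mulVec_sub, huv', sub_self]; exact le_rfl) p
    have h2 := hA (v - u) (fun q => by rw [Matrix.mulVec_sub, huv', sub_self]; exact le_rfl) p
    exact le_antisymm (sub_nonneg.1 h2) (sub_nonneg.1 h1)
  refine ⟨hunit, fun p q => hA (fun r => A⁻¹ r q) (fun r => ?_) p⟩
  -- The product of `A` with a column of its inverse is a column of the identity.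
  have h : (A *ᵥ fun s => A⁻¹ s q) r = (A * A⁻¹) r q := rfl
  rw [h, Matrix.mul_nonsing_inv A ((Matrix.isUnit_iff_isUnit_det A).1 hunit), Matrix.one_apply]
  split_ifs <;> norm_num

theorem discreteMaximumPrinciple_q2Matrix {N : ℕ} {hx hy : ℕ → ℝ} (hxp : ∀ k < N, 0 < hx k)
    (hyp : ∀ k < N, 0 < hy k) (hm : MeshConstraints N hx hy) :
    DiscreteMaximumPrinciple N (q2Matrix N hx hy) := by
  intro u hu p _
  obtain ⟨M, hM⟩ : ∃ M, M = max 0 (⨆ q : {q : GridIdx N // OnBoundary N q.1 q.2}, u q) := ⟨_, rfl⟩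
  rw [← hM]
  have hbdry : ∀ q : GridIdx N, OnBoundary N q.1 q.2 → u q ≤ M := fun q hq => by
    rw [hM]
    exact (le_ciSup (f := fun q : {q : GridIdx N // OnBoundary N q.1 q.2} => u q)
      (Set.finite_range _).bddAbove ⟨q, hq⟩).trans (le_max_right _ _)
  have key := nonneg_of_q2Scheme_nonneg hxp hyp hm
    (u := (fun _ _ => M) + (-1 : ℝ) • gridExtend u) (fun i hi j hj => ?_)
    p.1 (by omega) p.2 (by omega)
  · simp only [Pi.add_apply, Pi.smul_apply, gridExtend_apply, smul_eq_mul] at key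
    linarith
  · let q : GridIdx N := (⟨i, by omega⟩, ⟨j, by omega⟩)
    rw [q2Scheme_add, q2Scheme_smul]
    by_cases hb : OnBoundary N i j
    · rw [q2Scheme_of_onBoundary hx hy _ hb, q2Scheme_of_onBoundary hx hy _ hb]
      have h1 := hbdry q hb
      have h2 : gridExtend u i j = u q := gridExtend_apply u q
      linarith
    · obtain ⟨⟨hi0, hiN⟩, hj0, hjN⟩ := (not_onBoundary_iff hi hj).1 hb
      have h1 := hu q hb
      rw [q2Matrix_mulVec] at h1
      have h2 : q2Scheme N hx hy (gridExtend u) i j ≤ 0 := h1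
      rw [q2Scheme_const hxp hyp M hi0 hiN hj0 hjN]
      linarith

theorem AxisMesh.h_pos {N : ℕ} (X : AxisMesh N) : ∀ k < N, 0 < X.h k := by
  intro k hk
  unfold AxisMesh.h
  rw [dif_pos hk]
  have := X.strictMono (show (⟨k, by omega⟩ : Fin (N + 1)) < ⟨k + 1, by omega⟩ by simp)
  linarith

theorem mainTheorem1 (N : ℕ) (hN : 1 ≤ N) (X Y : AxisMesh N)
    (hmesh : MeshConstraints N X.h Y.h) :
    IsMonotoneMatrix (q2Matrix N X.h Y.h) ∧
      DiscreteMaximumPrinciple N (q2Matrix N X.h Y.h) :=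
  ⟨isMonotoneMatrix_of_forall_nonneg fun _ hu =>
      nonneg_of_q2Matrix_mulVec_nonneg X.h_pos Y.h_pos hmesh hu,
    discreteMaximumPrinciple_q2Matrix X.h_pos Y.h_pos hmesh⟩
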